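/- Let $U=\begin{pmatrix} a & b\\ c & d\end{pmatrix}$ be a $2\times 2$ complex unitary matrix with $abcd\neq 0$, and let $\varphi={}^t[\alpha,\beta]\in\mathbb{C}^2$ with $|\alpha|^2+|\beta|^2=1$. Put $P=\begin{pmatrix} a & b\\ 0 & 0\end{pmatrix}$ and $Q=\begin{pmatrix} 0 & 0\\ c & d\end{pmatrix}$, and define $\Psi^{(n)}_k\in\mathbb{C}^2$ for $n\ge 0$, $k\in\mathbb{Z}$ by $\Psi^{(0)}_0=\varphi$, $\Psi^{(0)}_k=0$ for $k\neq 0$, and $\Psi^{(n+1)}_k=Q\Psi^{(n)}_{k-1}+P\Psi^{(n)}_{k+1}$. For each $n$ let $X_n^{\varphi}$ (the quantum random walk at time $n$) be a $\mathbb{Z}$-valued random variable with $P(X_n^{\varphi}=k)=\|\Psi^{(n)}_k\|^2$ for all $k\in\mathbb{Z}$. Then, as $n\to\infty$, $X_n^{\varphi}/n$ converges in law to a random variable $Z^{\varphi}$ whose distribution has the (nonnegative) density $$f_{\alpha,\beta}(x)=\frac{\sqrt{1-|a|^2}\,(1-\lambda_{\alpha,\beta}\,x)}{\pi(1-x^2)\sqrt{|a|^2-x^2}}\quad\text{for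 } x\in(-|a|,|a|),\qquad f_{\alpha,\beta}(x)=0\quad\text{for } |x|\ge |a|,$$ where $$\lambda_{\alpha,\beta}=|\alpha|^2-|\beta|^2+\frac{a\alpha\,\overline{b\beta}+\overline{a\alpha}\,b\beta}{|a|^2}.$$ -/

import Mathlib

open MeasureTheory ProbabilityTheory Filter Matrix
open scoped ENNReal ComplexConjugate

namespace QuantumWalk

/-- The initial qubit states `φ = ᵗ[α, β] ∈ ℂ²` with `|α|² + |β|² = 1`. -/
structure InitialQubit where
  /-- The left component. -/
  alpha : ℂ
  /-- The right component. -/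
  beta : ℂ
  norm_eq : ‖alpha‖ ^ 2 + ‖beta‖ ^ 2 = 1

/-- The vector `ᵗ[α, β]`. -/
def InitialQubit.vec (φ : InitialQubit) : Fin 2 → ℂ := ![φ.alpha, φ.beta]

/-- The part `P` of `U = P + Q` that moves the particle one unit to the left. -/
def leftPart (U : Matrix (Fin 2) (Fin 2) ℂ) : Matrix (Fin 2) (Fin 2) ℂ :=
  !![U 0 0, U 0 1; 0, 0]

/-- The part `Q` of `U = P + Q` that moves the particle one unit to the right. -/
def rightPart (U : Matrix (Fin 2) (Fin 2) ℂ) : Matrix (Fin 2) (Fin 2) ℂ :=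
  !![0, 0; U 1 0, U 1 1]

/-- The two-component amplitude `Ψ_k^{(n)}(φ)` at time `n` and site `k ∈ ℤ`: the walk starts at the
origin in the state `φ`, and `Ψ_k^{(n+1)} = Q Ψ_{k-1}^{(n)} + P Ψ_{k+1}^{(n)}`. -/
noncomputable def amplitude (U : Matrix (Fin 2) (Fin 2) ℂ) (φ : Fin 2 → ℂ) :
    ℕ → ℤ → (Fin 2 → ℂ)
  | 0 => fun k => if k = 0 then φ else 0
  | n + 1 => fun k =>
      rightPart U *ᵥ amplitude U φ n (k - 1) + leftPart U *ᵥ amplitude U φ n (k + 1)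

/-- The squared Euclidean norm `‖Ψ_k^{(n)}(φ)‖²`, the probability of site `k` at time `n`. -/
noncomputable def siteProb (U : Matrix (Fin 2) (Fin 2) ℂ) (φ : Fin 2 → ℂ) (n : ℕ) (k : ℤ) : ℝ :=
  ‖amplitude U φ n k 0‖ ^ 2 + ‖amplitude U φ n k 1‖ ^ 2

theorem normSq_unitary (U : Matrix.unitaryGroup (Fin 2) ℂ) (v : Fin 2 → ℂ) :
    ‖(U.1 *ᵥ v) 0‖ ^ 2 + ‖(U.1 *ᵥ v) 1‖ ^ 2 = ‖v 0‖ ^ 2 + ‖v 1‖ ^ 2 := by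
  have key : ∀ w : Fin 2 → ℂ, star w ⬝ᵥ w = ((‖w 0‖ ^ 2 + ‖w 1‖ ^ 2 : ℝ) : ℂ) := by
    intro w
    simp [dotProduct, Fin.sum_univ_two, Complex.conj_mul']
  have h : star (U.1 *ᵥ v) ⬝ᵥ (U.1 *ᵥ v) = star v ⬝ᵥ v := by
    rw [Matrix.star_mulVec, ← Matrix.dotProduct_mulVec, Matrix.mulVec_mulVec,
      ← Matrix.star_eq_conjTranspose, Matrix.mem_unitaryGroup_iff'.1 U.2, Matrix.one_mulVec]
  rw [key, key] at h
  exact_mod_cast h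

/-- Unitarity of `U` makes the total probability equal to one at every time. -/
theorem tsum_siteProb (U : Matrix.unitaryGroup (Fin 2) ℂ) (φ : InitialQubit) (n : ℕ) :
    ∑' k : ℤ, ENNReal.ofReal (siteProb U.1 φ.vec n k) = 1 := by
  induction n with
  | zero =>
    rw [tsum_eq_single 0]
    · simp [siteProb, amplitude, InitialQubit.vec, φ.norm_eq]
    · intro k hk
      simp [siteProb, amplitude, hk]
  | succ n ih =>
    have hstep : ∀ k : ℤ, ENNReal.ofReal (siteProb U.1 φ.vec (n + 1) k) =
        ENNReal.ofReal (‖(U.1 *ᵥ amplitude U.1 φ.vec n (k + 1)) 0‖ ^ 2) +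
        ENNReal.ofReal (‖(U.1 *ᵥ amplitude U.1 φ.vec n (k - 1)) 1‖ ^ 2) := by
      intro k
      rw [← ENNReal.ofReal_add (by positivity) (by positivity)]
      congr 1
      simp [siteProb, amplitude, leftPart, rightPart, Matrix.mulVec, dotProduct,
        Fin.sum_univ_two]
    simp_rw [hstep]
    have hl := (Equiv.addRight (1 : ℤ)).tsum_eq
      (fun k => ENNReal.ofReal (‖(U.1 *ᵥ amplitude U.1 φ.vec n k) 0‖ ^ 2))
    have hr := (Equiv.subRight (1 : ℤ)).tsum_eq
      (fun k => ENNReal.ofReal (‖(U.1 *ᵥ amplitude U.1 φ.vec n k) 1‖ ^ 2))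
    simp only [Equiv.coe_addRight, Equiv.subRight_apply] at hl hr
    rw [ENNReal.tsum_add, hl, hr, ← ENNReal.tsum_add, ← ih]
    refine tsum_congr fun k => ?_
    rw [← ENNReal.ofReal_add (by positivity) (by positivity), normSq_unitary]
    rfl

/-- The distribution on `ℤ` of the quantum random walk at time `n`:
`P(X_n^φ = k) = ‖Ψ_k^{(n)}(φ)‖²`. -/
noncomputable def walkPMF (U : Matrix.unitaryGroup (Fin 2) ℂ) (φ : InitialQubit) (n : ℕ) :
    PMF ℤ :=
  ⟨fun k => ENNReal.ofReal (siteProb U.1 φ.vec n k),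
    tsum_siteProb U φ n ▸ ENNReal.summable.hasSum⟩

/-- `λ_{α,β} = |α|² - |β|² + (a α conj(b β) + conj(a α) b β) / |a|²`; the numerator of the last
term is a real number. -/
noncomputable def lam (U : Matrix.unitaryGroup (Fin 2) ℂ) (φ : InitialQubit) : ℝ :=
  ‖φ.alpha‖ ^ 2 - ‖φ.beta‖ ^ 2 +
    (U.1 0 0 * φ.alpha * conj (U.1 0 1 * φ.beta) +
      conj (U.1 0 0 * φ.alpha) * (U.1 0 1 * φ.beta)).re / ‖U.1 0 0‖ ^ 2

/-- The limit density `f_{α,β}`, supported on `(-|a|, |a|)`. -/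
noncomputable def limitDensity (U : Matrix.unitaryGroup (Fin 2) ℂ) (φ : InitialQubit)
    (x : ℝ) : ℝ :=
  if |x| < ‖U.1 0 0‖ then
    √(1 - ‖U.1 0 0‖ ^ 2) * (1 - lam U φ * x) /
      (Real.pi * (1 - x ^ 2) * √(‖U.1 0 0‖ ^ 2 - x ^ 2))
  else 0

end QuantumWalk

/-!
The convergence is proved through characteristic functions and Lévy's continuity theorem.

Rephasing the two rows of the coin is a gauge transformation: it multiplies every amplitude by a
phase and does not change the probabilities (`siteProb_gauge`). One may therefore replace `U` by a
coin in `SU(2)` with rows `(r, b)` and `(-conj b, r)`, where `r = |a|`. By Parseval's identity the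
characteristic function of `X_n / n` at `ξ` is the mean over one period of the correlation
`⟨M(t)ⁿ φ, M(t + ξ / n)ⁿ φ⟩`, where `M(t)` is the one-step evolution at frequency `t`
(`charFun_map_walk`, `integral_correlation`).

Now `M(t) ∈ SU(2)` has trace `2 r cos t = 2 cos ω(t)`, so `M(t) = cos ω(t) + sin ω(t) A(t)` with
`A(t)` skew-Hermitian and `A(t)² = -1`, and `M(t)ⁿ = cos (n ω(t)) + sin (n ω(t)) A(t)`
(`trigSeries_amplitude_eq`). Replacing `A(t + ξ / n)` by `A(t)` costs `o(1)`, and the rest of the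
correlation depends on `n` only through `n (ω(t + ξ / n) - ω(t)) → ξ ω'(t)`. So the correlation
converges pointwise to `cos (ξ ω'(t)) + sin (ξ ω'(t)) ⟨φ, A(t) φ⟩` (`tendsto_correlation`) and the
integrals converge by dominated convergence; no stationary phase argument is needed.

Finally `⟨φ, A(t) φ⟩ = -i λ ω'(t)` up to a term that is odd under `t ↦ π - t`, and the limit becomes
the mean of `(1 - λ ω'(t)) exp (i ξ ω'(t))` over `(-π/2, π/2)` (`integral_limit_eq`). There
`x = ω'(t)` increases from `-r` to `r`, and this change of variables produces the density
(`integral_konnoDensity_mul`). The density is nonnegative because `r λ` is the expectation of a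
Hermitian matrix with eigenvalues `± 1` (`abs_mul_lam_le`).
-/

namespace QuantumWalk

/-! ### Reduction to a coin with real diagonal -/

theorem amplitude_succ_zero (U : Matrix (Fin 2) (Fin 2) ℂ) (v : Fin 2 → ℂ) (n : ℕ) (k : ℤ) :
    amplitude U v (n + 1) k 0 =
      U 0 0 * amplitude U v n (k + 1) 0 + U 0 1 * amplitude U v n (k + 1) 1 := by
  simp [amplitude, leftPart, rightPart, dotProduct, Fin.sum_univ_two]

theorem amplitude_succ_one (U : Matrix (Fin 2) (Fin 2) ℂ) (v : Fin 2 → ℂ) (n : ℕ) (k : ℤ) :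
    amplitude U v (n + 1) k 1 =
      U 1 0 * amplitude U v n (k - 1) 0 + U 1 1 * amplitude U v n (k - 1) 1 := by
  simp [amplitude, leftPart, rightPart, dotProduct, Fin.sum_univ_two]

/-- Multiplying the rows of the coin by `p` and `p * y ^ 2` multiplies the amplitude at time `n` and
site `k` by `(p * y) ^ n * y ^ k`. -/
theorem amplitude_gauge {U V : Matrix (Fin 2) (Fin 2) ℂ} {p y : ℂ} (hy : y ≠ 0)
    (h0 : ∀ j, V 0 j = p * U 0 j) (h1 : ∀ j, V 1 j = p * y ^ 2 * U 1 j)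
    (v : Fin 2 → ℂ) (n : ℕ) (k : ℤ) (j : Fin 2) :
    amplitude V v n k j = (p * y) ^ n * y ^ k * amplitude U v n k j := by
  induction n generalizing k j with
  | zero =>
    by_cases hk : k = 0 <;> simp [amplitude, hk]
  | succ n ih =>
    fin_cases j
    · simp only [Fin.zero_eta, amplitude_succ_zero, ih, h0, zpow_add_one₀ hy]
      ring
    · simp only [Fin.mk_one, amplitude_succ_one, ih, h1, zpow_sub_one₀ hy]
      field_simp
      ring

theorem siteProb_gauge {U V : Matrix (Fin 2) (Fin 2) ℂ} {p q : ℂ} (hp : ‖p‖ = 1) (hq : ‖q‖ = 1)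
    (h0 : ∀ j, V 0 j = p * U 0 j) (h1 : ∀ j, V 1 j = q * U 1 j)
    (v : Fin 2 → ℂ) (n : ℕ) (k : ℤ) :
    siteProb V v n k = siteProb U v n k := by
  have hp0 : p ≠ 0 := by
    rintro rfl
    simp at hp
  -- `amplitude_gauge` needs row phases of the form `p` and `p * y ^ 2`
  obtain ⟨y, hy⟩ := IsAlgClosed.exists_pow_nat_eq (q / p) (n := 2) (by norm_num)
  have hy1 : ‖y‖ = 1 := by
    have : ‖y‖ ^ 2 = 1 := by rw [← norm_pow, hy, norm_div, hp, hq, div_one]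
    exact (pow_eq_one_iff_of_nonneg (norm_nonneg _) two_ne_zero).1 this
  have hy0 : y ≠ 0 := by
    rintro rfl
    simp at hy1
  have hq' : p * y ^ 2 = q := by
    rw [hy]
    field_simp
  have key := amplitude_gauge (U := U) (V := V) hy0 h0 (by simpa [hq'] using h1) v n k
  simp [siteProb, key, hp, hy1]

/-- The coin with rows `(r, b)` and `(-conj b, r)`, where `r` is real. When `r ^ 2 + ‖b‖ ^ 2 = 1` it
lies in `SU(2)`. -/
def realDiagCoin (r : ℝ) (b : ℂ) : Matrix (Fin 2) (Fin 2) ℂ :=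
  !![(r : ℂ), b; -conj b, (r : ℂ)]

/-- The first row of a unitary coin has unit length, its diagonal entries have the same modulus, and
its two rows are orthogonal. -/
theorem unitary_row_relations (U : Matrix.unitaryGroup (Fin 2) ℂ) :
    ‖U.1 0 0‖ ^ 2 + ‖U.1 0 1‖ ^ 2 = 1 ∧ ‖U.1 1 1‖ = ‖U.1 0 0‖ ∧
      U.1 1 0 * conj (U.1 0 0) + U.1 1 1 * conj (U.1 0 1) = 0 := by
  have h := Matrix.mem_unitaryGroup_iff.1 U.2
  have h' := Matrix.mem_unitaryGroup_iff'.1 U.2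
  have h00 := congrFun (congrFun h 0) 0
  have h10 := congrFun (congrFun h 1) 0
  have h11 := congrFun (congrFun h' 1) 1
  simp only [Matrix.mul_apply, Fin.sum_univ_two, Matrix.star_apply, Matrix.one_apply_eq,
    RCLike.star_def, Complex.mul_conj', Complex.conj_mul'] at h00 h11
  have e1 : ‖U.1 0 0‖ ^ 2 + ‖U.1 0 1‖ ^ 2 = 1 := by exact_mod_cast h00
  have e2 : ‖U.1 0 1‖ ^ 2 + ‖U.1 1 1‖ ^ 2 = 1 := by exact_mod_cast h11
  refine ⟨e1, ?_, ?_⟩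
  · exact (pow_left_inj₀ (norm_nonneg _) (norm_nonneg _) two_ne_zero).1 (by linarith)
  · simpa [Matrix.mul_apply, Fin.sum_univ_two] using h10

/-- Up to phases of the two rows, every unitary coin with nonzero diagonal is `realDiagCoin`. -/
theorem siteProb_eq_realDiagCoin (U : Matrix.unitaryGroup (Fin 2) ℂ) (ha : U.1 0 0 ≠ 0)
    (v : Fin 2 → ℂ) (n : ℕ) (k : ℤ) :
    siteProb (realDiagCoin ‖U.1 0 0‖ (U.1 0 1 * (‖U.1 0 0‖ / U.1 0 0))) v n k =
      siteProb U.1 v n k := by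
  obtain ⟨-, hd, horth⟩ := unitary_row_relations U
  have hr : ‖U.1 0 0‖ ≠ 0 := norm_ne_zero_iff.2 ha
  have hd0 : U.1 1 1 ≠ 0 := norm_ne_zero_iff.1 (hd ▸ hr)
  refine siteProb_gauge (p := ‖U.1 0 0‖ / U.1 0 0) (q := ‖U.1 0 0‖ / U.1 1 1) ?_ ?_ ?_ ?_ v n k
  · simp [hr]
  · simp [hd, hr]
  · intro j
    fin_cases j
    · simp [realDiagCoin, ha]
    · simp [realDiagCoin, mul_comm]
  · intro j
    fin_cases j
    · simp only [realDiagCoin, Fin.zero_eta, Matrix.of_apply, Matrix.cons_val',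
        Matrix.cons_val_zero, Matrix.cons_val_one, Matrix.cons_val_fin_one, map_mul,
        map_div₀, Complex.conj_ofReal]
      have hca : conj (U.1 0 0) ≠ 0 := (map_ne_zero _).2 ha
      field_simp
      linear_combination -(‖U.1 0 0‖ : ℂ) * horth
    · simp [realDiagCoin, hd0]

/-! ### The Fourier transform of the amplitude -/

theorem amplitude_eq_zero (U : Matrix (Fin 2) (Fin 2) ℂ) (v : Fin 2 → ℂ) (n : ℕ) (k : ℤ)
    (h : (n : ℤ) < |k|) (j : Fin 2) : amplitude U v n k j = 0 := by
  induction n generalizing k j with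
  | zero =>
    have : k ≠ 0 := by
      rintro rfl
      simp at h
    simp [amplitude, this]
  | succ n ih =>
    have h1 : (n : ℤ) < |k + 1| := by grind
    have h2 : (n : ℤ) < |k - 1| := by grind
    fin_cases j
    · simp [amplitude_succ_zero, ih _ h1]
    · simp [amplitude_succ_one, ih _ h2]

theorem finite_support_amplitude (U : Matrix (Fin 2) (Fin 2) ℂ) (v : Fin 2 → ℂ) (n : ℕ)
    (j : Fin 2) : (Function.support fun k => amplitude U v n k j).Finite := by
  refine (Set.finite_Icc (-(n : ℤ)) n).subset fun k hk => ?_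
  by_contra hk'
  exact hk (amplitude_eq_zero U v n k (by grind) j)

/-- The trigonometric series `∑ₖ c k * exp (i k t)`. -/
noncomputable def trigSeries (c : ℤ → ℂ) (t : ℝ) : ℂ :=
  ∑' k : ℤ, Complex.exp (k * t * Complex.I) * c k

theorem integral_exp_int_mul (a : ℝ) (m : ℤ) :
    ∫ t in a..a + 2 * Real.pi, Complex.exp (m * t * Complex.I) =
      if m = 0 then (2 * Real.pi : ℂ) else 0 := by
  split_ifs with hm
  · simp [hm]
  · have hc : (m * Complex.I : ℂ) ≠ 0 := mul_ne_zero (by exact_mod_cast hm) Complex.I_ne_zero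
    have e : ∀ t : ℝ, (m * t * Complex.I : ℂ) = m * Complex.I * t := fun t => by ring
    simp_rw [e]
    rw [integral_exp_mul_complex hc]
    have : Complex.exp (m * Complex.I * ((a + 2 * Real.pi : ℝ) : ℂ)) =
        Complex.exp (m * Complex.I * a) := by
      rw [Complex.exp_eq_exp_iff_exists_int]
      exact ⟨m, by push_cast; ring⟩
    rw [this, sub_self, zero_div]

/-- Parseval's identity for a finitely supported sequence and its translate in frequency. -/
theorem integral_conj_trigSeries_mul {c : ℤ → ℂ} (hc : (Function.support c).Finite) (a h : ℝ) :
    ∫ t in a..a + 2 * Real.pi, conj (trigSeries c t) * trigSeries c (t + h) =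
      2 * Real.pi * ∑' k : ℤ, (‖c k‖ ^ 2 : ℂ) * Complex.exp (k * h * Complex.I) := by
  set S := hc.toFinset with hS
  have h0 : ∀ k ∉ S, c k = 0 := by
    intro k hk
    simpa [hS] using hk
  have e1 : ∀ t, trigSeries c t = ∑ k ∈ S, Complex.exp (k * t * Complex.I) * c k := fun t =>
    tsum_eq_sum fun k hk => by simp [h0 k hk]
  have e2 : ∑' k : ℤ, (‖c k‖ ^ 2 : ℂ) * Complex.exp (k * h * Complex.I) =
      ∑ k ∈ S, (‖c k‖ ^ 2 : ℂ) * Complex.exp (k * h * Complex.I) :=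
    tsum_eq_sum fun k hk => by simp [h0 k hk]
  have e3 : ∀ t : ℝ, conj (trigSeries c t) * trigSeries c (t + h) =
      ∑ k ∈ S, ∑ l ∈ S, conj (c k) * c l * Complex.exp (l * h * Complex.I) *
        Complex.exp (((l - k : ℤ) : ℂ) * t * Complex.I) := by
    intro t
    rw [e1, e1, map_sum, Finset.sum_mul_sum]
    refine Finset.sum_congr rfl fun k _ => Finset.sum_congr rfl fun l _ => ?_
    rw [map_mul, ← Complex.exp_conj]
    have : (((l - k : ℤ) : ℂ) * t * Complex.I) =
        conj (k * t * Complex.I : ℂ) + l * t * Complex.I := by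
      simp
      ring
    rw [this, Complex.exp_add]
    have : (l * ((t + h : ℝ) : ℂ) * Complex.I) = l * t * Complex.I + l * h * Complex.I := by
      push_cast
      ring
    rw [this, Complex.exp_add]
    ring
  simp_rw [e3, e2]
  rw [intervalIntegral.integral_finsetSum]
  · rw [Finset.mul_sum]
    refine Finset.sum_congr rfl fun k hk => ?_
    rw [intervalIntegral.integral_finsetSum]
    · simp_rw [intervalIntegral.integral_const_mul, integral_exp_int_mul]
      rw [Finset.sum_eq_single k]
      · simp only [sub_self, if_true, Complex.conj_mul']
        ring
      · intro l _ hl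
        simp [sub_eq_zero, hl]
      · exact fun h => absurd hk h
    · exact fun l _ => Continuous.intervalIntegrable (by fun_prop) _ _
  · exact fun l _ => Continuous.intervalIntegrable (by fun_prop) _ _

theorem trigSeries_amplitude_zero (U : Matrix (Fin 2) (Fin 2) ℂ) (v : Fin 2 → ℂ) (t : ℝ)
    (j : Fin 2) : trigSeries (fun k => amplitude U v 0 k j) t = v j := by
  rw [trigSeries, tsum_eq_single 0]
  · simp [amplitude]
  · intro k hk
    simp [amplitude, hk]

theorem summable_exp_mul_amplitude (U : Matrix (Fin 2) (Fin 2) ℂ) (v : Fin 2 → ℂ) (n : ℕ) (t : ℝ)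
    (j : Fin 2) :
    Summable fun k : ℤ => Complex.exp (k * t * Complex.I) * amplitude U v n k j := by
  refine summable_of_hasFiniteSupport ((finite_support_amplitude U v n j).subset ?_)
  intro k hk
  exact right_ne_zero_of_mul hk

theorem trigSeries_amplitude_succ_zero (U : Matrix (Fin 2) (Fin 2) ℂ) (v : Fin 2 → ℂ) (n : ℕ)
    (t : ℝ) :
    trigSeries (fun k => amplitude U v (n + 1) k 0) t = Complex.exp (-(t * Complex.I)) *
      (U 0 0 * trigSeries (fun k => amplitude U v n k 0) t +
        U 0 1 * trigSeries (fun k => amplitude U v n k 1) t) := by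
  simp only [trigSeries]
  rw [← (Equiv.subRight (1 : ℤ)).tsum_eq, ← tsum_mul_left, ← tsum_mul_left,
    ← ((summable_exp_mul_amplitude U v n t 0).mul_left _).tsum_add
      ((summable_exp_mul_amplitude U v n t 1).mul_left _), ← tsum_mul_left]
  refine tsum_congr fun k => ?_
  rw [Equiv.subRight_apply, amplitude_succ_zero, sub_add_cancel]
  have : (((k - 1 : ℤ) : ℂ) * t * Complex.I) = -(t * Complex.I) + k * t * Complex.I := by
    push_cast
    ring
  rw [this, Complex.exp_add]
  ring

theorem trigSeries_amplitude_succ_one (U : Matrix (Fin 2) (Fin 2) ℂ) (v : Fin 2 → ℂ) (n : ℕ)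
    (t : ℝ) :
    trigSeries (fun k => amplitude U v (n + 1) k 1) t = Complex.exp (t * Complex.I) *
      (U 1 0 * trigSeries (fun k => amplitude U v n k 0) t +
        U 1 1 * trigSeries (fun k => amplitude U v n k 1) t) := by
  simp only [trigSeries]
  rw [← (Equiv.addRight (1 : ℤ)).tsum_eq, ← tsum_mul_left, ← tsum_mul_left,
    ← ((summable_exp_mul_amplitude U v n t 0).mul_left _).tsum_add
      ((summable_exp_mul_amplitude U v n t 1).mul_left _), ← tsum_mul_left]
  refine tsum_congr fun k => ?_
  rw [Equiv.coe_addRight, amplitude_succ_one, add_sub_cancel_right]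
  have : (((k + 1 : ℤ) : ℂ) * t * Complex.I) = t * Complex.I + k * t * Complex.I := by
    push_cast
    ring
  rw [this, Complex.exp_add]
  ring

/-- The correlation `⟨Ψ̂ₙ(t), Ψ̂ₙ(t + h)⟩` of the Fourier transform of the amplitude at two
frequencies. -/
noncomputable def correlation (U : Matrix (Fin 2) (Fin 2) ℂ) (v : Fin 2 → ℂ) (n : ℕ) (h t : ℝ) :
    ℂ :=
  conj (trigSeries (fun k => amplitude U v n k 0) t) *
      trigSeries (fun k => amplitude U v n k 0) (t + h) +
    conj (trigSeries (fun k => amplitude U v n k 1) t) *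
      trigSeries (fun k => amplitude U v n k 1) (t + h)

theorem continuous_trigSeries {c : ℤ → ℂ} (hc : (Function.support c).Finite) :
    Continuous (trigSeries c) := by
  have : trigSeries c =
      fun t : ℝ => ∑ k ∈ hc.toFinset, Complex.exp (k * t * Complex.I) * c k := by
    funext t
    exact tsum_eq_sum fun k hk => by
      have : c k = 0 := by simpa using hk
      simp [this]
  rw [this]
  fun_prop

theorem continuous_correlation (U : Matrix (Fin 2) (Fin 2) ℂ) (v : Fin 2 → ℂ) (n : ℕ) (h : ℝ) :
    Continuous (correlation U v n h) := by
  have h0 := continuous_trigSeries (finite_support_amplitude U v n 0)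
  have h1 := continuous_trigSeries (finite_support_amplitude U v n 1)
  have e : Continuous fun t : ℝ => t + h := by fun_prop
  exact ((Complex.continuous_conj.comp h0).mul (h0.comp e)).add
    ((Complex.continuous_conj.comp h1).mul (h1.comp e))

theorem integral_correlation (U : Matrix (Fin 2) (Fin 2) ℂ) (v : Fin 2 → ℂ) (n : ℕ) (a h : ℝ) :
    ∫ t in a..a + 2 * Real.pi, correlation U v n h t =
      2 * Real.pi * ∑' k : ℤ, (siteProb U v n k : ℂ) * Complex.exp (k * h * Complex.I) := by
  have e : Continuous fun t : ℝ => t + h := by fun_prop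
  have hi : ∀ j : Fin 2, IntervalIntegrable (fun t =>
      conj (trigSeries (fun k => amplitude U v n k j) t) *
        trigSeries (fun k => amplitude U v n k j) (t + h)) volume a (a + 2 * Real.pi) := by
    intro j
    have hj := continuous_trigSeries (finite_support_amplitude U v n j)
    exact ((Complex.continuous_conj.comp hj).mul (hj.comp e)).intervalIntegrable _ _
  have hs : ∀ j : Fin 2, Summable fun k : ℤ =>
      (‖amplitude U v n k j‖ ^ 2 : ℂ) * Complex.exp (k * h * Complex.I) := by
    intro j
    refine summable_of_hasFiniteSupport ((finite_support_amplitude U v n j).subset ?_)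
    intro k hk hk'
    have : amplitude U v n k j = 0 := hk'
    simp [this] at hk
  simp only [correlation]
  rw [intervalIntegral.integral_add (hi 0) (hi 1),
    integral_conj_trigSeries_mul (finite_support_amplitude U v n 0),
    integral_conj_trigSeries_mul (finite_support_amplitude U v n 1), ← mul_add,
    ← (hs 0).tsum_add (hs 1)]
  congr 1
  refine tsum_congr fun k => ?_
  simp only [siteProb]
  push_cast
  ring

/-- The characteristic function of the walk divided by `s`, as a sum over the sites; for `s = n` it
is evaluated by `integral_correlation`. -/
theorem charFun_map_walk {Ω : Type*} [MeasurableSpace Ω] {μ : Measure Ω}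
    (U : Matrix.unitaryGroup (Fin 2) ℂ) (φ : InitialQubit) (n : ℕ) {X : Ω → ℤ}
    (hX : HasLaw X (walkPMF U φ n).toMeasure μ) (s ξ : ℝ) :
    charFun (μ.map fun ω => (X ω : ℝ) / s) ξ =
      ∑' k : ℤ, (siteProb U.1 φ.vec n k : ℂ) * Complex.exp (k * (ξ / s : ℝ) * Complex.I) := by
  have hm : Measurable fun k : ℤ => (k : ℝ) / s := measurable_of_countable _
  have e1 : μ.map (fun ω => (X ω : ℝ) / s) =
      (walkPMF U φ n).toMeasure.map fun k : ℤ => (k : ℝ) / s := by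
    rw [← hX.map_eq, AEMeasurable.map_map_of_aemeasurable hm.aemeasurable hX.aemeasurable]
    rfl
  rw [e1, charFun_apply_real, integral_map hm.aemeasurable (by fun_prop), PMF.integral_eq_tsum]
  · refine tsum_congr fun k => ?_
    have h0 : 0 ≤ siteProb U.1 φ.vec n k := by
      unfold siteProb
      positivity
    have h1 : ((walkPMF U φ n) k).toReal = siteProb U.1 φ.vec n k := ENNReal.toReal_ofReal h0
    rw [h1, Complex.real_smul]
    congr 2
    push_cast
    ring
  · refine Integrable.of_bound (C := 1) (measurable_of_countable _).aestronglyMeasurable ?_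
    refine Eventually.of_forall fun k => ?_
    rw [← Complex.ofReal_mul, Complex.norm_exp_ofReal_mul_I]

/-! ### Spectral form of the one-step evolution in frequency space -/

/-- The phase `ω(t)` with `cos ω(t) = r cos t`: at frequency `t` the one-step evolution with coin
`realDiagCoin r b` has the eigenvalues `exp (± i ω(t))`. -/
noncomputable def dispersion (r t : ℝ) : ℝ := Real.arccos (r * Real.cos t)

/-- The sine of the phase, `sin ω(t) = √(1 - r² cos² t)`. -/
noncomputable def sinDispersion (r t : ℝ) : ℝ := √(1 - (r * Real.cos t) ^ 2)

/-- The derivative `ω'(t) = r sin t / √(1 - r² cos² t)` of the phase. -/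
noncomputable def groupVelocity (r t : ℝ) : ℝ := r * Real.sin t / sinDispersion r t

/-- The vector `A(t) v`, where `A(t) = (M(t) - cos ω(t)) / sin ω(t)` and `M(t)` is the one-step
evolution with coin `realDiagCoin r b` at frequency `t`. The matrix `A(t)` is skew-Hermitian with
square `-1`. -/
noncomputable def quarterTurn (r : ℝ) (b : ℂ) (v : Fin 2 → ℂ) (t : ℝ) : Fin 2 → ℂ :=
  ![(-(Complex.I * r * Real.sin t) * v 0 + b * Complex.exp (-(t * Complex.I)) * v 1) /
      sinDispersion r t,
    (-(conj b * Complex.exp (t * Complex.I)) * v 0 + Complex.I * r * Real.sin t * v 1) /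
      sinDispersion r t]

theorem mul_cos_sq_lt_one {r : ℝ} (hr : r ^ 2 < 1) (t : ℝ) : (r * Real.cos t) ^ 2 < 1 := by
  rw [mul_pow]
  exact (mul_le_of_le_one_right (sq_nonneg r) (Real.cos_sq_le_one t)).trans_lt hr

theorem sinDispersion_pos {r : ℝ} (hr : r ^ 2 < 1) (t : ℝ) : 0 < sinDispersion r t :=
  Real.sqrt_pos.2 (sub_pos.2 (mul_cos_sq_lt_one hr t))

theorem sq_sinDispersion {r : ℝ} (hr : r ^ 2 < 1) (t : ℝ) :
    sinDispersion r t ^ 2 = 1 - (r * Real.cos t) ^ 2 :=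
  Real.sq_sqrt (sub_pos.2 (mul_cos_sq_lt_one hr t)).le

theorem cos_dispersion {r : ℝ} (hr : r ^ 2 < 1) (t : ℝ) :
    Real.cos (dispersion r t) = r * Real.cos t := by
  have h := abs_lt.1 ((sq_lt_one_iff_abs_lt_one _).1 (mul_cos_sq_lt_one hr t))
  exact Real.cos_arccos h.1.le h.2.le

theorem sin_dispersion (r t : ℝ) : Real.sin (dispersion r t) = sinDispersion r t :=
  Real.sin_arccos _

theorem hasDerivAt_dispersion {r : ℝ} (hr : r ^ 2 < 1) (t : ℝ) :
    HasDerivAt (dispersion r) (groupVelocity r t) t := by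
  have h := mul_cos_sq_lt_one hr t
  have h1 : r * Real.cos t ≠ -1 := by
    intro e
    rw [e] at h
    norm_num at h
  have h2 : r * Real.cos t ≠ 1 := by
    intro e
    rw [e] at h
    norm_num at h
  have := (Real.hasDerivAt_arccos h1 h2).comp t ((Real.hasDerivAt_cos t).const_mul r)
  refine this.congr_deriv ?_
  simp only [groupVelocity, sinDispersion]
  ring

theorem continuous_sinDispersion (r : ℝ) : Continuous (sinDispersion r) := by
  unfold sinDispersion
  fun_prop

theorem continuous_groupVelocity {r : ℝ} (hr : r ^ 2 < 1) : Continuous (groupVelocity r) := by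
  unfold groupVelocity
  have := continuous_sinDispersion r
  exact Continuous.div (by fun_prop) this fun t => (sinDispersion_pos hr t).ne'

theorem continuous_quarterTurn {r : ℝ} (hr : r ^ 2 < 1) (b : ℂ) (v : Fin 2 → ℂ) (j : Fin 2) :
    Continuous fun t => quarterTurn r b v t j := by
  have h := continuous_sinDispersion r
  have h' : Continuous fun t => (sinDispersion r t : ℂ) := by fun_prop
  have h0 : ∀ t, (sinDispersion r t : ℂ) ≠ 0 := fun t => by
    exact_mod_cast (sinDispersion_pos hr t).ne'
  fin_cases j
  · exact Continuous.div (by fun_prop) h' h0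
  · exact Continuous.div (by fun_prop) h' h0

theorem exp_mul_I_eq (t : ℝ) :
    Complex.exp (t * Complex.I) = Real.cos t + Complex.I * Real.sin t := by
  rw [Complex.exp_mul_I]
  push_cast
  ring

theorem exp_neg_mul_I_eq (t : ℝ) :
    Complex.exp (-(t * Complex.I)) = Real.cos t - Complex.I * Real.sin t := by
  rw [← neg_mul, ← Complex.ofReal_neg, exp_mul_I_eq, Real.cos_neg, Real.sin_neg]
  push_cast
  ring

/-- The closed form `M(t)ⁿ v = cos (n ω(t)) v + sin (n ω(t)) A(t) v`, a De Moivre formula that holds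
because `M(t) = cos ω(t) + sin ω(t) A(t)` with `A(t) ^ 2 = -1`. -/
theorem trigSeries_amplitude_eq {r : ℝ} {b : ℂ} (hr : r ^ 2 < 1) (hb : r ^ 2 + ‖b‖ ^ 2 = 1)
    (v : Fin 2 → ℂ) (n : ℕ) (t : ℝ) (j : Fin 2) :
    trigSeries (fun k => amplitude (realDiagCoin r b) v n k j) t =
      Real.cos (n * dispersion r t) * v j +
        Real.sin (n * dispersion r t) * quarterTurn r b v t j := by
  have hs : (sinDispersion r t : ℂ) ≠ 0 := by exact_mod_cast (sinDispersion_pos hr t).ne'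
  have hs2 : (sinDispersion r t : ℂ) ^ 2 = 1 - (r * Real.cos t) ^ 2 := by
    exact_mod_cast sq_sinDispersion hr t
  have hb' : (r : ℂ) ^ 2 + b * conj b = 1 := by
    rw [Complex.mul_conj']
    exact_mod_cast hb
  have hI := Complex.I_sq
  have hcs : (Real.cos t : ℂ) ^ 2 + (Real.sin t : ℂ) ^ 2 = 1 := by
    exact_mod_cast Real.cos_sq_add_sin_sq t
  induction n generalizing j with
  | zero => simp [trigSeries_amplitude_zero]
  | succ n ih =>
    have ec : (Real.cos ((n + 1 : ℕ) * dispersion r t) : ℂ) =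
        Real.cos (n * dispersion r t) * (r * Real.cos t) -
          Real.sin (n * dispersion r t) * sinDispersion r t := by
      rw [Nat.cast_succ, add_one_mul, Real.cos_add, cos_dispersion hr, sin_dispersion]
      push_cast
      ring
    have es : (Real.sin ((n + 1 : ℕ) * dispersion r t) : ℂ) =
        Real.sin (n * dispersion r t) * (r * Real.cos t) +
          Real.cos (n * dispersion r t) * sinDispersion r t := by
      rw [Nat.cast_succ, add_one_mul, Real.sin_add, cos_dispersion hr, sin_dispersion]
      push_cast
      ring
    rw [ec, es]
    generalize (Real.cos (n * dispersion r t) : ℂ) = C at *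
    generalize (Real.sin (n * dispersion r t) : ℂ) = S at *
    fin_cases j
    · simp only [Fin.zero_eta, trigSeries_amplitude_succ_zero, ih]
      simp only [quarterTurn, realDiagCoin, Matrix.of_apply, Matrix.cons_val', Matrix.cons_val_zero,
        Matrix.cons_val_one, Matrix.cons_val_fin_one, exp_mul_I_eq, exp_neg_mul_I_eq]
      generalize (Real.cos t : ℂ) = x at *
      generalize (Real.sin t : ℂ) = y at *
      generalize (sinDispersion r t : ℂ) = z at *
      field_simp
      generalize conj b = b' at *
      clear ih ec es
      grind
    · simp only [Fin.mk_one, trigSeries_amplitude_succ_one, ih]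
      simp only [quarterTurn, realDiagCoin, Matrix.of_apply, Matrix.cons_val', Matrix.cons_val_zero,
        Matrix.cons_val_one, Matrix.cons_val_fin_one, exp_mul_I_eq, exp_neg_mul_I_eq]
      generalize (Real.cos t : ℂ) = x at *
      generalize (Real.sin t : ℂ) = y at *
      generalize (sinDispersion r t : ℂ) = z at *
      field_simp
      generalize conj b = b' at *
      clear ih ec es
      grind

/-- The matrix `A(t)` is unitary: it preserves the length of a unit vector. -/
theorem quarterTurn_inner_self {r : ℝ} {b : ℂ} (hr : r ^ 2 < 1) (hb : r ^ 2 + ‖b‖ ^ 2 = 1)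
    {v : Fin 2 → ℂ} (hv : ‖v 0‖ ^ 2 + ‖v 1‖ ^ 2 = 1) (t : ℝ) :
    conj (quarterTurn r b v t 0) * quarterTurn r b v t 0 +
      conj (quarterTurn r b v t 1) * quarterTurn r b v t 1 = 1 := by
  have hs : (sinDispersion r t : ℂ) ≠ 0 := by exact_mod_cast (sinDispersion_pos hr t).ne'
  have hs2 : (sinDispersion r t : ℂ) ^ 2 = 1 - (r * Real.cos t) ^ 2 := by
    exact_mod_cast sq_sinDispersion hr t
  have hb' : (r : ℂ) ^ 2 + b * conj b = 1 := by
    rw [Complex.mul_conj']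
    exact_mod_cast hb
  have hv' : v 0 * conj (v 0) + v 1 * conj (v 1) = 1 := by
    rw [Complex.mul_conj', Complex.mul_conj']
    exact_mod_cast hv
  have hI := Complex.I_sq
  have hcs : (Real.cos t : ℂ) ^ 2 + (Real.sin t : ℂ) ^ 2 = 1 := by
    exact_mod_cast Real.cos_sq_add_sin_sq t
  simp only [quarterTurn, Matrix.cons_val_zero, Matrix.cons_val_one,
    Matrix.cons_val_fin_one, exp_mul_I_eq, exp_neg_mul_I_eq, map_div₀, map_add, map_mul, map_sub,
    map_neg, Complex.conj_ofReal, Complex.conj_I, Complex.conj_conj]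
  generalize (Real.cos t : ℂ) = x at *
  generalize (Real.sin t : ℂ) = y at *
  generalize (sinDispersion r t : ℂ) = z at *
  generalize conj b = b' at *
  generalize conj (v 0) = v0' at *
  generalize conj (v 1) = v1' at *
  field_simp
  grind

/-- The expectation `⟨v, A(t) v⟩`. It is purely imaginary since `A(t)` is skew-Hermitian. -/
noncomputable def quarterTurnExpectation (r : ℝ) (b : ℂ) (v : Fin 2 → ℂ) (t : ℝ) : ℂ :=
  conj (v 0) * quarterTurn r b v t 0 + conj (v 1) * quarterTurn r b v t 1

theorem quarterTurn_inner_eq_neg (r : ℝ) (b : ℂ) (v : Fin 2 → ℂ) (t : ℝ) :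
    conj (quarterTurn r b v t 0) * v 0 + conj (quarterTurn r b v t 1) * v 1 =
      -quarterTurnExpectation r b v t := by
  simp only [quarterTurnExpectation, quarterTurn, Matrix.cons_val_zero, Matrix.cons_val_one,
    Matrix.cons_val_fin_one, exp_mul_I_eq, exp_neg_mul_I_eq, map_div₀, map_add, map_mul, map_sub,
    map_neg, Complex.conj_ofReal, Complex.conj_I, Complex.conj_conj]
  ring

/-- The expectation `⟨v, A(t) v⟩` is a multiple of the group velocity, up to a term that is odd
under `t ↦ π - t`. -/
theorem quarterTurnExpectation_eq {r : ℝ} (hr0 : r ≠ 0) (b : ℂ) (v : Fin 2 → ℂ) (t : ℝ) :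
    quarterTurnExpectation r b v t =
      -Complex.I * ((‖v 0‖ ^ 2 - ‖v 1‖ ^ 2 + 2 * (conj (v 0) * v 1 * b).re / r : ℝ) : ℂ) *
          groupVelocity r t +
        2 * Complex.I * (conj (v 0) * v 1 * b).im * (Real.cos t / sinDispersion r t : ℝ) := by
  have h0 : ((‖v 0‖ ^ 2 : ℝ) : ℂ) = v 0 * conj (v 0) := by
    rw [Complex.mul_conj']
    push_cast
    rfl
  have h1 : ((‖v 1‖ ^ 2 : ℝ) : ℂ) = v 1 * conj (v 1) := by
    rw [Complex.mul_conj']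
    push_cast
    rfl
  have hre := Complex.re_eq_add_conj (conj (v 0) * v 1 * b)
  have him := Complex.im_eq_sub_conj (conj (v 0) * v 1 * b)
  have hr0' : (r : ℂ) ≠ 0 := by exact_mod_cast hr0
  simp only [map_mul, Complex.conj_conj] at hre him
  simp only [quarterTurnExpectation, quarterTurn, Matrix.cons_val_zero, Matrix.cons_val_one,
    Matrix.cons_val_fin_one, exp_mul_I_eq, exp_neg_mul_I_eq, groupVelocity, Complex.ofReal_add,
    Complex.ofReal_sub, Complex.ofReal_div, Complex.ofReal_mul, h0, h1, hre, him,
    Complex.ofReal_ofNat]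
  field_simp
  ring

/-! ### The limit of the correlation -/

theorem norm_le_one_of_inner_self {x y : ℂ} (h : conj x * x + conj y * y = 1) :
    ‖x‖ ≤ 1 ∧ ‖y‖ ≤ 1 := by
  rw [Complex.conj_mul', Complex.conj_mul'] at h
  have h' : ‖x‖ ^ 2 + ‖y‖ ^ 2 = 1 := by exact_mod_cast h
  constructor <;> nlinarith [norm_nonneg x, norm_nonneg y]

theorem norm_correlation_le {r : ℝ} {b : ℂ} (hr : r ^ 2 < 1) (hb : r ^ 2 + ‖b‖ ^ 2 = 1)
    {v : Fin 2 → ℂ} (hv : ‖v 0‖ ^ 2 + ‖v 1‖ ^ 2 = 1) (n : ℕ) (h t : ℝ) :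
    ‖correlation (realDiagCoin r b) v n h t‖ ≤ 8 := by
  have hv' : ∀ j, ‖v j‖ ≤ 1 := by
    intro j
    fin_cases j <;> simp only [Fin.zero_eta, Fin.mk_one] <;>
      nlinarith [norm_nonneg (v 0), norm_nonneg (v 1)]
  have hw : ∀ t j, ‖quarterTurn r b v t j‖ ≤ 1 := by
    intro t j
    have := norm_le_one_of_inner_self (quarterTurn_inner_self hr hb hv t)
    fin_cases j
    · exact this.1
    · exact this.2
  have hT : ∀ t j, ‖trigSeries (fun k => amplitude (realDiagCoin r b) v n k j) t‖ ≤ 2 := by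
    intro t j
    rw [trigSeries_amplitude_eq hr hb]
    refine (norm_add_le _ _).trans ?_
    rw [norm_mul, norm_mul, Complex.norm_real, Complex.norm_real, Real.norm_eq_abs,
      Real.norm_eq_abs]
    have h1 := mul_le_one₀ (Real.abs_cos_le_one (n * dispersion r t)) (norm_nonneg _) (hv' j)
    have h2 := mul_le_one₀ (Real.abs_sin_le_one (n * dispersion r t)) (norm_nonneg _) (hw t j)
    linarith
  refine (norm_add_le _ _).trans ?_
  rw [norm_mul, norm_mul, RCLike.norm_conj, RCLike.norm_conj]
  have h0 := mul_le_mul (hT t 0) (hT (t + h) 0) (norm_nonneg _) zero_le_two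
  have h1 := mul_le_mul (hT t 1) (hT (t + h) 1) (norm_nonneg _) zero_le_two
  linarith

theorem tendsto_nat_mul_dispersion_sub {r : ℝ} (hr : r ^ 2 < 1) (ξ t : ℝ) :
    Tendsto (fun n : ℕ => (n : ℝ) * (dispersion r (t + ξ / n) - dispersion r t)) atTop
      (nhds (ξ * groupVelocity r t)) := by
  have h1 : HasDerivAt (fun s : ℝ => dispersion r (t + ξ * s)) (groupVelocity r t * ξ) 0 := by
    have h2 : HasDerivAt (fun s : ℝ => t + ξ * s) ξ 0 := by
      simpa using ((hasDerivAt_id (0 : ℝ)).const_mul ξ).const_add t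
    have h3 := hasDerivAt_dispersion hr (t + ξ * 0)
    have h4 := h3.comp (0 : ℝ) h2
    simpa [Function.comp_def] using h4
  have h2 := hasDerivAt_iff_tendsto_slope_zero.1 h1
  have h3 : Tendsto (fun n : ℕ => ((n : ℝ))⁻¹) atTop (nhdsWithin 0 {0}ᶜ) := by
    refine tendsto_nhdsWithin_iff.2 ⟨tendsto_inv_atTop_nhds_zero_nat, ?_⟩
    filter_upwards [eventually_gt_atTop 0] with n hn
    simp [hn.ne']
  have h4 := h2.comp h3
  rw [mul_comm ξ]
  refine h4.congr fun n => ?_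
  simp [div_eq_mul_inv]

/-- The oscillations of `cos (n ω)` and `sin (n ω)` at the frequencies `t` and `t + ξ / n` cancel up
to the phase difference `n (ω(t + ξ / n) - ω(t))`, which converges. -/
theorem tendsto_correlation {r : ℝ} {b : ℂ} (hr : r ^ 2 < 1) (hb : r ^ 2 + ‖b‖ ^ 2 = 1)
    {v : Fin 2 → ℂ} (hv : ‖v 0‖ ^ 2 + ‖v 1‖ ^ 2 = 1) (ξ t : ℝ) :
    Tendsto (fun n : ℕ => correlation (realDiagCoin r b) v n (ξ / n) t) atTop
      (nhds (Real.cos (ξ * groupVelocity r t) +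
        Real.sin (ξ * groupVelocity r t) * quarterTurnExpectation r b v t)) := by
  set w := quarterTurn r b v with hw
  have hv' : conj (v 0) * v 0 + conj (v 1) * v 1 = 1 := by
    rw [Complex.conj_mul', Complex.conj_mul']
    exact_mod_cast hv
  have hanti := quarterTurn_inner_eq_neg r b v t
  rw [← hw] at hanti
  have hshift : Tendsto (fun n : ℕ => t + ξ / n) atTop (nhds t) := by
    simpa using (tendsto_const_div_atTop_nhds_zero_nat ξ).const_add t
  have hK : Tendsto (fun n : ℕ => conj (w t 0) * w (t + ξ / n) 0 +
      conj (w t 1) * w (t + ξ / n) 1 - 1) atTop (nhds 0) := by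
    have hc : Continuous fun u => conj (w t 0) * w u 0 + conj (w t 1) * w u 1 - 1 := by
      have h0 := continuous_quarterTurn hr b v 0
      have h1 := continuous_quarterTurn hr b v 1
      fun_prop
    have := (hc.tendsto t).comp hshift
    rwa [show conj (w t 0) * w t 0 + conj (w t 1) * w t 1 - 1 = 0 from
      sub_eq_zero.2 (quarterTurn_inner_self hr hb hv t)] at this
  have hG : Tendsto (fun n : ℕ => quarterTurnExpectation r b v (t + ξ / n) -
      quarterTurnExpectation r b v t) atTop (nhds 0) := by
    have hc : Continuous fun u => quarterTurnExpectation r b v u -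
        quarterTurnExpectation r b v t := by
      have h0 := continuous_quarterTurn hr b v 0
      have h1 := continuous_quarterTurn hr b v 1
      unfold quarterTurnExpectation
      fun_prop
    have := (hc.tendsto t).comp hshift
    rwa [sub_self] at this
  have hbdd : ∀ (p q : ℕ → ℝ), (∀ n, |p n| ≤ 1) → (∀ n, |q n| ≤ 1) → ∀ f : ℕ → ℂ,
      Tendsto f atTop (nhds 0) → Tendsto (fun n => (p n : ℂ) * q n * f n) atTop (nhds 0) := by
    intro p q hp hq f hf
    refine squeeze_zero_norm (fun n => ?_) (tendsto_zero_iff_norm_tendsto_zero.1 hf)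
    rw [norm_mul, norm_mul, Complex.norm_real, Complex.norm_real]
    exact mul_le_of_le_one_left (norm_nonneg _) (mul_le_one₀ (hp n) (abs_nonneg _) (hq n))
  have h1 := hbdd (fun n => Real.sin (n * dispersion r t))
    (fun n => Real.sin (n * dispersion r (t + ξ / n))) (fun n => Real.abs_sin_le_one _)
    (fun n => Real.abs_sin_le_one _) _ hK
  have h2 := hbdd (fun n => Real.cos (n * dispersion r t))
    (fun n => Real.sin (n * dispersion r (t + ξ / n))) (fun n => Real.abs_cos_le_one _)
    (fun n => Real.abs_sin_le_one _) _ hG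
  have hd := tendsto_nat_mul_dispersion_sub hr ξ t
  have h3 := (Complex.continuous_ofReal.tendsto _).comp ((Real.continuous_cos.tendsto _).comp hd)
  have h4 := ((Complex.continuous_ofReal.tendsto _).comp
    ((Real.continuous_sin.tendsto _).comp hd)).mul_const (quarterTurnExpectation r b v t)
  have h5 := ((h3.add h4).add h1).add h2
  rw [add_zero, add_zero] at h5
  refine h5.congr fun n => ?_
  simp only [correlation, trigSeries_amplitude_eq hr hb, Function.comp_apply, mul_sub,
    Real.cos_sub, Real.sin_sub]
  rw [← hw]
  have hG' : quarterTurnExpectation r b v (t + ξ / n) =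
      conj (v 0) * w (t + ξ / n) 0 + conj (v 1) * w (t + ξ / n) 1 := rfl
  rw [hG']
  simp only [map_add, map_mul, Complex.conj_ofReal, Complex.ofReal_add, Complex.ofReal_sub,
    Complex.ofReal_mul]
  generalize quarterTurnExpectation r b v t = G at *
  linear_combination (-(Real.sin (n * dispersion r t) : ℂ) *
      Real.cos (n * dispersion r (t + ξ / n))) * hanti -
    ((Real.cos (n * dispersion r t) : ℂ) * Real.cos (n * dispersion r (t + ξ / n))) * hv'

theorem tendsto_integral_correlation {r : ℝ} {b : ℂ} (hr : r ^ 2 < 1) (hb : r ^ 2 + ‖b‖ ^ 2 = 1)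
    {v : Fin 2 → ℂ} (hv : ‖v 0‖ ^ 2 + ‖v 1‖ ^ 2 = 1) (a c ξ : ℝ) :
    Tendsto (fun n : ℕ => ∫ t in a..c, correlation (realDiagCoin r b) v n (ξ / n) t) atTop
      (nhds (∫ t in a..c, (Real.cos (ξ * groupVelocity r t) +
        Real.sin (ξ * groupVelocity r t) * quarterTurnExpectation r b v t))) := by
  refine intervalIntegral.tendsto_integral_filter_of_dominated_convergence (fun _ => 8) ?_ ?_
    intervalIntegrable_const ?_
  · exact Eventually.of_forall fun n => (continuous_correlation _ _ _ _).aestronglyMeasurable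
  · exact Eventually.of_forall fun n => Eventually.of_forall fun t _ =>
      norm_correlation_le hr hb hv n _ t
  · exact Eventually.of_forall fun t _ => tendsto_correlation hr hb hv ξ t

/-! ### Symmetries of the limiting integral -/

theorem sinDispersion_neg (r t : ℝ) : sinDispersion r (-t) = sinDispersion r t := by
  simp [sinDispersion]

theorem sinDispersion_pi_sub (r t : ℝ) : sinDispersion r (Real.pi - t) = sinDispersion r t := by
  simp [sinDispersion]

theorem groupVelocity_neg (r t : ℝ) : groupVelocity r (-t) = -groupVelocity r t := by
  simp [groupVelocity, sinDispersion_neg, neg_div]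

theorem groupVelocity_pi_sub (r t : ℝ) : groupVelocity r (Real.pi - t) = groupVelocity r t := by
  simp [groupVelocity, sinDispersion_pi_sub]

/-- A function that is odd about the midpoint of an interval has integral zero over it. -/
theorem intervalIntegral_eq_zero_of_odd {f : ℝ → ℂ} {d a b : ℝ} (hd : a + b = d)
    (hf : ∀ t, f (d - t) = -f t) : ∫ t in a..b, f t = 0 := by
  have h := intervalIntegral.integral_comp_sub_left (a := a) (b := b) f d
  simp_rw [hf, intervalIntegral.integral_neg] at h
  rw [show d - b = a by linarith, show d - a = b by linarith] at h
  exact self_eq_neg.1 h.symm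

/-- The limit of the characteristic functions, folded onto `[-π/2, π/2]`: the terms that are odd
under `t ↦ π - t` or `t ↦ -t` drop out. -/
theorem integral_limit_eq {r : ℝ} (hr0 : r ≠ 0) (hr : r ^ 2 < 1) (b : ℂ) (v : Fin 2 → ℂ) {l : ℝ}
    (hl : l = ‖v 0‖ ^ 2 - ‖v 1‖ ^ 2 + 2 * (conj (v 0) * v 1 * b).re / r) (ξ : ℝ) :
    ∫ t in -(Real.pi / 2)..-(Real.pi / 2) + 2 * Real.pi, (Real.cos (ξ * groupVelocity r t) +
        Real.sin (ξ * groupVelocity r t) * quarterTurnExpectation r b v t) =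
      2 * ∫ t in -(Real.pi / 2)..Real.pi / 2,
        ((1 - l * groupVelocity r t : ℝ) : ℂ) *
          Complex.exp (ξ * groupVelocity r t * Complex.I) := by
  set x := groupVelocity r with hx
  have hxc : Continuous x := continuous_groupVelocity hr
  have hsc := continuous_sinDispersion r
  set m : ℝ := (conj (v 0) * v 1 * b).im with hm
  set H : ℝ → ℂ := fun t => Real.cos (ξ * x t) - Complex.I * l * (x t * Real.sin (ξ * x t))
    with hH
  set E : ℝ → ℂ := fun t => 2 * Complex.I * m * (Real.cos t / sinDispersion r t : ℝ) *
    Real.sin (ξ * x t) with hE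
  have hHc : Continuous H := by fun_prop
  have hEc : Continuous E := by
    have : Continuous fun t => Real.cos t / sinDispersion r t :=
      Real.continuous_cos.div hsc fun t => (sinDispersion_pos hr t).ne'
    fun_prop
  have e1 : ∀ t, (Real.cos (ξ * x t) + Real.sin (ξ * x t) * quarterTurnExpectation r b v t : ℂ) =
      H t + E t := by
    intro t
    rw [quarterTurnExpectation_eq hr0, ← hl, ← hx, ← hm]
    simp only [hH, hE]
    ring
  have hE0 : ∫ t in -(Real.pi / 2)..-(Real.pi / 2) + 2 * Real.pi, E t = 0 := by
    refine intervalIntegral_eq_zero_of_odd (d := Real.pi) (by ring) fun t => ?_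
    simp only [hE, hx, groupVelocity_pi_sub, sinDispersion_pi_sub, Real.cos_pi_sub, neg_div]
    push_cast
    ring
  have hH2 : ∫ t in Real.pi / 2..-(Real.pi / 2) + 2 * Real.pi, H t =
      ∫ t in -(Real.pi / 2)..Real.pi / 2, H t := by
    have h := intervalIntegral.integral_comp_sub_left (a := -(Real.pi / 2)) (b := Real.pi / 2) H
      Real.pi
    have e : ∀ t, H (Real.pi - t) = H t := fun t => by
      simp only [hH, hx, groupVelocity_pi_sub]
    simp_rw [e] at h
    rw [h]
    congr 1 <;> ring
  set O : ℝ → ℂ := fun t => Complex.I * Real.sin (ξ * x t) - l * x t * Real.cos (ξ * x t) with hO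
  have hOc : Continuous O := by fun_prop
  have hO0 : ∫ t in -(Real.pi / 2)..Real.pi / 2, O t = 0 := by
    refine intervalIntegral_eq_zero_of_odd (d := 0) (by ring) fun t => ?_
    simp only [hO, hx, zero_sub, groupVelocity_neg, mul_neg, Real.sin_neg, Real.cos_neg]
    push_cast
    ring
  have e2 : ∀ t, ((1 - l * x t : ℝ) : ℂ) * Complex.exp (ξ * x t * Complex.I) = H t + O t := by
    intro t
    rw [← Complex.ofReal_mul, exp_mul_I_eq]
    simp only [hH, hO]
    push_cast
    ring
  simp_rw [e1, e2]
  rw [intervalIntegral.integral_add (hHc.intervalIntegrable _ _) (hEc.intervalIntegrable _ _),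
    intervalIntegral.integral_add (hHc.intervalIntegrable _ _) (hOc.intervalIntegrable _ _), hE0,
    hO0, ← intervalIntegral.integral_add_adjacent_intervals (b := Real.pi / 2)
      (hHc.intervalIntegrable _ _) (hHc.intervalIntegrable _ _), hH2]
  ring

/-! ### The group velocity as a change of variables -/

theorem hasDerivAt_groupVelocity {r : ℝ} (hr : r ^ 2 < 1) (t : ℝ) :
    HasDerivAt (groupVelocity r) (r * Real.cos t * (1 - r ^ 2) / sinDispersion r t ^ 3) t := by
  have h0 := sinDispersion_pos hr t
  have h1 : HasDerivAt (sinDispersion r)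
      (r ^ 2 * Real.cos t * Real.sin t / sinDispersion r t) t := by
    have h2 := ((((Real.hasDerivAt_cos t).const_mul r).pow 2).const_sub 1).sqrt
      (sub_pos.2 (mul_cos_sq_lt_one hr t)).ne'
    refine h2.congr_deriv ?_
    simp only [sinDispersion] at h0 ⊢
    simp
    field_simp
  refine (((Real.hasDerivAt_sin t).const_mul r).div h1 h0.ne').congr_deriv ?_
  have hs := sq_sinDispersion hr t
  have hcs := Real.sin_sq_add_cos_sq t
  field_simp
  rw [hs]
  linear_combination -r ^ 3 * Real.cos t * hcs

theorem one_sub_sq_groupVelocity {r : ℝ} (hr : r ^ 2 < 1) (t : ℝ) :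
    1 - groupVelocity r t ^ 2 = (1 - r ^ 2) / sinDispersion r t ^ 2 := by
  have h0 := (sinDispersion_pos hr t).ne'
  have hs := sq_sinDispersion hr t
  have hcs := Real.sin_sq_add_cos_sq t
  rw [groupVelocity]
  field_simp
  rw [hs]
  linear_combination -r ^ 2 * hcs

theorem sq_sub_sq_groupVelocity {r : ℝ} (hr : r ^ 2 < 1) (t : ℝ) :
    r ^ 2 - groupVelocity r t ^ 2 = (1 - r ^ 2) * (r * Real.cos t / sinDispersion r t) ^ 2 := by
  have h0 := (sinDispersion_pos hr t).ne'
  have hs := sq_sinDispersion hr t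
  have hcs := Real.sin_sq_add_cos_sq t
  rw [groupVelocity]
  field_simp
  rw [hs]
  linear_combination -r ^ 2 * hcs

theorem abs_groupVelocity_lt {r : ℝ} (hr0 : 0 < r) (hr : r ^ 2 < 1) {t : ℝ}
    (ht : t ∈ Set.Ioo (-(Real.pi / 2)) (Real.pi / 2)) : |groupVelocity r t| < r := by
  refine abs_lt_of_sq_lt_sq ?_ hr0.le
  rw [← sub_pos, sq_sub_sq_groupVelocity hr]
  have h1 := Real.cos_pos_of_mem_Ioo ht
  have h2 := sinDispersion_pos hr t
  have h3 : 0 < 1 - r ^ 2 := sub_pos.2 hr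
  positivity

theorem strictMonoOn_groupVelocity {r : ℝ} (hr0 : 0 < r) (hr : r ^ 2 < 1) :
    StrictMonoOn (groupVelocity r) (Set.Ioo (-(Real.pi / 2)) (Real.pi / 2)) := by
  refine strictMonoOn_of_deriv_pos (convex_Ioo _ _) (continuous_groupVelocity hr).continuousOn ?_
  intro t ht
  rw [interior_Ioo] at ht
  rw [(hasDerivAt_groupVelocity hr t).deriv]
  have h1 := Real.cos_pos_of_mem_Ioo ht
  have h2 := sinDispersion_pos hr t
  have h3 : 0 < 1 - r ^ 2 := sub_pos.2 hr
  positivity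

theorem image_groupVelocity {r : ℝ} (hr0 : 0 < r) (hr : r ^ 2 < 1) :
    groupVelocity r '' Set.Ioo (-(Real.pi / 2)) (Real.pi / 2) = {x | |x| < r} := by
  refine Set.Subset.antisymm ?_ fun x hx => ?_
  · rintro _ ⟨t, ht, rfl⟩
    exact abs_groupVelocity_lt hr0 hr ht
  · have hp := Real.pi_pos
    -- at the end points `± π / 2` the group velocity takes the values `± r`
    have hval : ∀ t, Real.cos t = 0 → groupVelocity r t = r * Real.sin t := by
      intro t ht
      simp [groupVelocity, sinDispersion, ht]
    have hx' := abs_lt.1 (Set.mem_ofPred_eq ▸ hx)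
    refine intermediate_value_Ioo (by linarith) (continuous_groupVelocity hr).continuousOn ?_
    rw [hval _ (by simp), hval _ (by simp)]
    simpa using hx'

/-- The limit density as a function of the two parameters `r = |a|` and `l = λ` on which it depends.
-/
noncomputable def konnoDensity (r l x : ℝ) : ℝ :=
  if |x| < r then √(1 - r ^ 2) * (1 - l * x) / (Real.pi * (1 - x ^ 2) * √(r ^ 2 - x ^ 2)) else 0

/-- The Jacobian of the group velocity turns the density into `(1 - λ x(t)) / π`. -/
theorem deriv_mul_konnoDensity {r : ℝ} (hr0 : 0 < r) (hr : r ^ 2 < 1) (l : ℝ) {t : ℝ}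
    (ht : t ∈ Set.Ioo (-(Real.pi / 2)) (Real.pi / 2)) :
    |r * Real.cos t * (1 - r ^ 2) / sinDispersion r t ^ 3| * konnoDensity r l (groupVelocity r t) =
      (1 - l * groupVelocity r t) / Real.pi := by
  have h1 := Real.cos_pos_of_mem_Ioo ht
  have h2 := sinDispersion_pos hr t
  have h3 : 0 < 1 - r ^ 2 := sub_pos.2 hr
  have h4 := Real.sqrt_pos.2 h3
  have h5 : (1 - r ^ 2) ≠ 0 := h3.ne'
  rw [konnoDensity, if_pos (abs_groupVelocity_lt hr0 hr ht), one_sub_sq_groupVelocity hr,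
    sq_sub_sq_groupVelocity hr, Real.sqrt_mul h3.le, Real.sqrt_sq (by positivity),
    abs_of_pos (by positivity)]
  generalize 1 - l * groupVelocity r t = u
  have hp := Real.pi_pos
  field_simp

theorem integral_konnoDensity_mul {r : ℝ} (hr0 : 0 < r) (hr : r ^ 2 < 1) (l : ℝ) (g : ℝ → ℂ) :
    ∫ x, (konnoDensity r l x : ℂ) * g x =
      (Real.pi : ℂ)⁻¹ * ∫ t in -(Real.pi / 2)..Real.pi / 2,
        ((1 - l * groupVelocity r t : ℝ) : ℂ) * g (groupVelocity r t) := by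
  have hs : Function.support (fun x => (konnoDensity r l x : ℂ) * g x) ⊆ {x | |x| < r} := by
    intro x hx
    by_contra h
    simp only [Set.mem_ofPred_eq] at h
    simp [konnoDensity, h] at hx
  rw [← setIntegral_eq_integral_of_forall_compl_eq_zero (s := {x | |x| < r})
      (fun x hx => by_contra fun h => hx (hs h)), ← image_groupVelocity hr0 hr,
    integral_image_eq_integral_abs_deriv_smul measurableSet_Ioo
      (fun t _ => (hasDerivAt_groupVelocity hr t).hasDerivWithinAt)
      (strictMonoOn_groupVelocity hr0 hr).injOn, intervalIntegral.integral_of_le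
      (by linarith [Real.pi_pos]), integral_Ioc_eq_integral_Ioo, ← integral_const_mul]
  refine setIntegral_congr_fun measurableSet_Ioo fun t ht => ?_
  have h := congrArg (fun y : ℝ => (y : ℂ)) (deriv_mul_konnoDensity hr0 hr l ht)
  simp only [Complex.ofReal_mul, Complex.ofReal_div] at h
  simp only [Complex.real_smul]
  rw [← mul_assoc, h]
  ring

theorem lintegral_konnoDensity {r l : ℝ} (hr0 : 0 < r) (hr : r ^ 2 < 1)
    (hl : ∀ x, |x| < r → 0 ≤ 1 - l * x) :
    ∫⁻ x, ENNReal.ofReal (konnoDensity r l x) = 1 := by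
  have hs : Function.support (fun x => ENNReal.ofReal (konnoDensity r l x)) ⊆ {x | |x| < r} := by
    intro x hx
    by_contra h
    simp only [Set.mem_ofPred_eq] at h
    simp [konnoDensity, h] at hx
  have hc : Continuous fun t => (1 - l * groupVelocity r t) / Real.pi := by
    have := continuous_groupVelocity hr
    fun_prop
  have hodd : ∫ t in -(Real.pi / 2)..Real.pi / 2, groupVelocity r t = 0 := by
    have := intervalIntegral_eq_zero_of_odd (f := fun t => (groupVelocity r t : ℂ))
      (a := -(Real.pi / 2)) (b := Real.pi / 2) (d := 0) (by ring)
      (fun t => by simp [groupVelocity_neg])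
    rw [intervalIntegral.integral_ofReal] at this
    exact_mod_cast this
  rw [← setLIntegral_eq_of_support_subset hs, ← image_groupVelocity hr0 hr,
    lintegral_image_eq_lintegral_abs_deriv_mul measurableSet_Ioo
      (fun t _ => (hasDerivAt_groupVelocity hr t).hasDerivWithinAt)
      (strictMonoOn_groupVelocity hr0 hr).injOn]
  calc _ = ∫⁻ t in Set.Ioo (-(Real.pi / 2)) (Real.pi / 2),
        ENNReal.ofReal ((1 - l * groupVelocity r t) / Real.pi) := by
        refine setLIntegral_congr_fun measurableSet_Ioo fun t ht => ?_
        rw [← ENNReal.ofReal_mul (abs_nonneg _), deriv_mul_konnoDensity hr0 hr l ht]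
    _ = ENNReal.ofReal (∫ t in Set.Ioo (-(Real.pi / 2)) (Real.pi / 2),
        (1 - l * groupVelocity r t) / Real.pi) := by
        rw [ofReal_integral_eq_lintegral_ofReal]
        · exact (hc.integrableOn_Icc).mono_set Set.Ioo_subset_Icc_self
        · refine (ae_restrict_iff' measurableSet_Ioo).2 (Eventually.of_forall fun t ht => ?_)
          exact div_nonneg (hl _ (abs_groupVelocity_lt hr0 hr ht)) Real.pi_pos.le
    _ = 1 := by
        rw [← integral_Ioc_eq_integral_Ioo, ← intervalIntegral.integral_of_le
          (by linarith [Real.pi_pos]), intervalIntegral.integral_div,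
          intervalIntegral.integral_sub (by simp)
            (((continuous_groupVelocity hr).const_mul l).intervalIntegrable _ _),
          intervalIntegral.integral_const_mul, hodd]
        have := Real.pi_pos.ne'
        simp [this]

/-! ### Positivity of the density -/

/-- The number `r λ` is the expectation in a unit vector of a Hermitian matrix with the eigenvalues
`1` and `-1`, hence at most `1` in absolute value. -/
theorem abs_mul_lam_le {r : ℝ} (hr0 : 0 < r) {b : ℂ} (hb : r ^ 2 + ‖b‖ ^ 2 = 1)
    {v : Fin 2 → ℂ} (hv : ‖v 0‖ ^ 2 + ‖v 1‖ ^ 2 = 1) :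
    |(‖v 0‖ ^ 2 - ‖v 1‖ ^ 2 + 2 * (conj (v 0) * v 1 * b).re / r) * r| ≤ 1 := by
  have h : |(conj (v 0) * v 1 * b).re| ≤ ‖v 0‖ * ‖v 1‖ * ‖b‖ := by
    simpa using Complex.abs_re_le_norm (conj (v 0) * v 1 * b)
  have e : (‖v 0‖ ^ 2 - ‖v 1‖ ^ 2 + 2 * (conj (v 0) * v 1 * b).re / r) * r =
      r * (‖v 0‖ ^ 2 - ‖v 1‖ ^ 2) + 2 * (conj (v 0) * v 1 * b).re := by
    field_simp
  rw [e]
  generalize (conj (v 0) * v 1 * b).re = R at *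
  generalize ‖v 0‖ = p at *
  generalize ‖v 1‖ = q at *
  generalize ‖b‖ = s at *
  have hA := abs_le.1 h
  -- Cauchy-Schwarz for the unit vectors `(r, s)` and `(p² - q², 2pq)`
  have e2 : (p ^ 2 - q ^ 2) ^ 2 + (2 * p * q) ^ 2 = 1 := by
    have : (p ^ 2 + q ^ 2) ^ 2 = 1 := by rw [hv, one_pow]
    linear_combination this
  rw [abs_le]
  constructor
  · nlinarith [sq_nonneg (r + (p ^ 2 - q ^ 2)), sq_nonneg (s - 2 * p * q)]
  · nlinarith [sq_nonneg (r - (p ^ 2 - q ^ 2)), sq_nonneg (s - 2 * p * q)]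

theorem konnoDensity_nonneg {r l : ℝ} (hr : r ^ 2 < 1) (hl : ∀ x, |x| < r → 0 ≤ 1 - l * x) (x : ℝ) :
    0 ≤ konnoDensity r l x := by
  unfold konnoDensity
  split_ifs with h
  · have h1 := hl x h
    have h2 : x ^ 2 < r ^ 2 := sq_lt_sq' (by linarith [(abs_lt.1 h).1]) (abs_lt.1 h).2
    have h3 : 0 < 1 - x ^ 2 := by linarith
    have := Real.pi_pos
    positivity
  · exact le_rfl

theorem measurable_konnoDensity (r l : ℝ) : Measurable (konnoDensity r l) := by
  unfold konnoDensity
  exact Measurable.ite (measurableSet_lt (by fun_prop) measurable_const) (by fun_prop)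
    measurable_const

theorem limitDensity_eq (U : Matrix.unitaryGroup (Fin 2) ℂ) (φ : InitialQubit) (x : ℝ) :
    limitDensity U φ x = konnoDensity ‖U.1 0 0‖ (lam U φ) x := rfl

/-- In terms of the off-diagonal entry `b |a| / a` of the reduced coin, `λ` has the form in which it
appears in `quarterTurnExpectation_eq`. -/
theorem lam_eq (U : Matrix.unitaryGroup (Fin 2) ℂ) (ha : U.1 0 0 ≠ 0) (φ : InitialQubit) :
    lam U φ = ‖φ.vec 0‖ ^ 2 - ‖φ.vec 1‖ ^ 2 +
      2 * (conj (φ.vec 0) * φ.vec 1 * (U.1 0 1 * (‖U.1 0 0‖ / U.1 0 0))).re / ‖U.1 0 0‖ := by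
  have hr : ‖U.1 0 0‖ ≠ 0 := norm_ne_zero_iff.2 ha
  have hinv : (U.1 0 0)⁻¹ = conj (U.1 0 0) * ((‖U.1 0 0‖ ^ 2 : ℝ) : ℂ)⁻¹ := by
    rw [Complex.inv_def, Complex.normSq_eq_norm_sq, Complex.ofReal_inv]
  have e : conj φ.alpha * φ.beta * (U.1 0 1 * (‖U.1 0 0‖ / U.1 0 0)) =
      ((‖U.1 0 0‖⁻¹ : ℝ) : ℂ) * (conj (U.1 0 0 * φ.alpha) * (U.1 0 1 * φ.beta)) := by
    rw [div_eq_mul_inv, hinv, map_mul]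
    push_cast
    field_simp
  have e' : U.1 0 0 * φ.alpha * conj (U.1 0 1 * φ.beta) =
      conj (conj (U.1 0 0 * φ.alpha) * (U.1 0 1 * φ.beta)) := by
    simp
  simp only [lam, InitialQubit.vec, Matrix.cons_val_zero, Matrix.cons_val_one,
    Matrix.cons_val_fin_one]
  rw [e, e', Complex.re_ofReal_mul, Complex.add_re, Complex.conj_re]
  field_simp
  ring

end QuantumWalk

open QuantumWalk in
theorem theorem1 (U : Matrix.unitaryGroup (Fin 2) ℂ)
    (hU : U.1 0 0 * U.1 0 1 * U.1 1 0 * U.1 1 1 ≠ 0)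
    (φ : QuantumWalk.InitialQubit)
    {Ω : ℕ → Type*} [∀ n, MeasurableSpace (Ω n)]
    (μ : (n : ℕ) → Measure (Ω n)) [∀ n, IsProbabilityMeasure (μ n)]
    (X : (n : ℕ) → Ω n → ℤ)
    (hX : ∀ n, HasLaw (X n) (QuantumWalk.walkPMF U φ n).toMeasure (μ n)) :
    (∀ x, 0 ≤ QuantumWalk.limitDensity U φ x) ∧
    ∃ (Ω' : Type) (_ : MeasurableSpace Ω') (μ' : Measure Ω') (_ : IsProbabilityMeasure μ')
      (Z : Ω' → ℝ),
      HasLaw Z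
        (volume.withDensity fun x => ENNReal.ofReal (QuantumWalk.limitDensity U φ x)) μ' ∧
      TendstoInDistribution (fun n ω => (X n ω : ℝ) / (n : ℝ)) atTop Z μ μ' := by
  have ha : U.1 0 0 ≠ 0 := fun h => hU (by simp [h])
  have hb0 : U.1 0 1 ≠ 0 := fun h => hU (by simp [h])
  have hlam := lam_eq U ha φ
  simp_rw [limitDensity_eq]
  set r : ℝ := ‖U.1 0 0‖ with hr_def
  set l : ℝ := lam U φ
  set b : ℂ := U.1 0 1 * (r / U.1 0 0) with hb_def
  have hr0 : 0 < r := norm_pos_iff.2 ha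
  have hnb : ‖b‖ = ‖U.1 0 1‖ := by
    rw [hb_def, norm_mul, norm_div, Complex.norm_real, hr_def, norm_norm, div_self hr0.ne', mul_one]
  have hb : r ^ 2 + ‖b‖ ^ 2 = 1 := by
    rw [hnb]
    exact (unitary_row_relations U).1
  have hr : r ^ 2 < 1 := by
    have : 0 < ‖b‖ := hnb ▸ norm_pos_iff.2 hb0
    nlinarith
  have hv : ‖φ.vec 0‖ ^ 2 + ‖φ.vec 1‖ ^ 2 = 1 := φ.norm_eq
  have hl : ∀ x, |x| < r → 0 ≤ 1 - l * x := by
    intro x hx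
    have h1 := abs_mul_lam_le hr0 hb hv
    rw [← hlam, abs_mul, abs_of_pos hr0] at h1
    have h2 : |l * x| ≤ |l| * r := by
      rw [abs_mul]
      exact mul_le_mul_of_nonneg_left hx.le (abs_nonneg _)
    linarith [le_abs_self (l * x)]
  have hprob : IsProbabilityMeasure
      (volume.withDensity fun x => ENNReal.ofReal (konnoDensity r l x)) := by
    refine ⟨?_⟩
    rw [withDensity_apply _ MeasurableSet.univ, setLIntegral_univ, lintegral_konnoDensity hr0 hr hl]
  refine ⟨konnoDensity_nonneg hr hl, ℝ, inferInstance, _, hprob, id, HasLaw.id, ?_⟩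
  have hmeas : ∀ n, AEMeasurable (fun ω => (X n ω : ℝ) / (n : ℝ)) (μ n) := fun n =>
    (measurable_of_countable (fun k : ℤ => (k : ℝ) / (n : ℝ))).comp_aemeasurable
      (hX n).aemeasurable
  refine ⟨hmeas, aemeasurable_id, ?_⟩
  refine ProbabilityMeasure.tendsto_iff_tendsto_charFun.2 fun ξ => ?_
  simp only [ProbabilityMeasure.coe_mk, Measure.map_id]
  have hpre : ∀ n : ℕ, charFun ((μ n).map fun ω => (X n ω : ℝ) / (n : ℝ)) ξ =
      (2 * Real.pi : ℂ)⁻¹ * ∫ t in -(Real.pi / 2)..-(Real.pi / 2) + 2 * Real.pi,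
        correlation (realDiagCoin r b) φ.vec n (ξ / n) t := by
    intro n
    have hp : (Real.pi : ℂ) ≠ 0 := by exact_mod_cast Real.pi_pos.ne'
    rw [charFun_map_walk U φ n (hX n), integral_correlation, inv_mul_cancel_left₀ (by simp [hp])]
    simp_rw [hb_def, hr_def, siteProb_eq_realDiagCoin U ha]
  have hlim : charFun (volume.withDensity fun x => ENNReal.ofReal (konnoDensity r l x)) ξ =
      (2 * Real.pi : ℂ)⁻¹ * ∫ t in -(Real.pi / 2)..-(Real.pi / 2) + 2 * Real.pi,
        (Real.cos (ξ * groupVelocity r t) +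
          Real.sin (ξ * groupVelocity r t) * quarterTurnExpectation r b φ.vec t : ℂ) := by
    rw [integral_limit_eq hr0.ne' hr b φ.vec hlam, charFun_apply_real,
      integral_withDensity_eq_integral_toReal_smul
        (measurable_konnoDensity r l).ennreal_ofReal (Eventually.of_forall fun x => by simp)]
    simp_rw [ENNReal.toReal_ofReal (konnoDensity_nonneg hr hl _), Complex.real_smul]
    rw [integral_konnoDensity_mul hr0 hr]
    ring
  simp_rw [hpre]
  rw [hlim]
  exact (tendsto_integral_correlation hr hb hv _ _ ξ).const_mul _
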